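/- Let $E$ be a finite set, let $\mathbf a=(a_i)_{i\in E}$ be nonnegative integers, let $\tilde E$ be a finite set and let $\pi\colon\tilde E\to E$ be a map with $|\pi^{-1}(i)|=a_i$ for all $i\in E$. Let $P$ be a polymatroid on $E$ of type $\mathbf a$, i.e. a function $\mathrm{rk}_P\colon 2^E\to\mathbb Z_{\ge0}$ that is submodular and monotone, with $\mathrm{rk}_P(\emptyset)=0$ and $\mathrm{rk}_P(\{i\})\le a_i$ for all $i\in E$. (A matroid is a polymatroid of type $(1,\dots,1)$.) A flat of $P$ is a subset $F\subseteq E$ with $\mathrm{rk}_P(F\cup\{x\})>\mathrm{rk}_P(F)$ for all $x\in E\setminus F$. The multisymmetric lift $M_\pi(P)$ is the matroid on $\tilde E$ with rank function $\mathrm{rk}(S)=\min\{\mathrm{rk}_P(A)+|S\setminus\pi^{-1}(A)| : A\subseteq E\}$. For $I\subseteq\tilde E$ and a (possibly empty) chain $\mathcal F=\{F_1\subsetneq\dots\subsetneq F_k\}$ of proper subsets of $E$, with the convention $F_{k+1}=E$, the pair $I\le\mathcal F$ is compatible if $A\subseteq F_1$ for every $A\subseteq E$ with $\pi^{-1}(A)\subseteq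 I$. Put $$\sigma_{I\le\mathcal F}=\mathrm{cone}\bigl(-\mathbf e_{\tilde E\setminus\pi^{-1}(F_1)},\dots,-\mathbf e_{\tilde E\setminus\pi^{-1}(F_k)}\bigr)+\mathrm{cone}(\mathbf e_j : j\in I)\subseteq\mathbb R^{\tilde E},\qquad \mathbf e_S=\sum_{j\in S}\mathbf e_j .$$ The polystellahedral fan $\Sigma_{\mathbf a}=\Sigma_\pi$ consists of the cones $\sigma_{I\le\mathcal F}$ of all compatible pairs. The augmented Bergman fan $\Sigma_P$ consists of the cones $\sigma_{S\le\mathcal F}$ of those compatible pairs for which every $F\in\mathcal F$ is a (proper) flat of $P$ and 1. $\mathrm{rk}_P(\pi(T))\ge|T|$ for all $T\subseteq S$; 2. $\mathrm{rk}_P(F\cup\pi(T))>\mathrm{rk}_P(F)+|T|$ for all $F\in\mathcal F$ and all nonempty $T\subseteq S\setminus\pi^{-1}(F)$. For a matroid $M$ on $\tilde E$, the augmented Bergman fan $\Sigma_M$ consists of the cones $\mathrm{cone}(-\mathbf e_{\tilde E\setminus F} : F\in\mathcal F)+\mathrm{cone}(\mathbf e_j : j\in I)$, where $I$ is an independent set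 of $M$ and $\mathcal F$ is a (possibly empty) chain of proper flats of $M$, all of which contain $I$. A fan is a finite nonempty set of strongly convex rational polyhedral cones that is closed under taking faces and in which any two cones meet in a common face; a subfan of a fan is a subset of its cones that is itself a fan. A fan $\Sigma$ is a coarsening of a fan $\Sigma'$ if they have the same support and every cone of $\Sigma'$ is contained in a cone of $\Sigma$. **Theorem.** $\Sigma_P$ is a subfan of the fan $\Sigma_{\mathbf a}$, and its support equals the support of $\Sigma_{M_\pi(P)}$; it is the only subfan of $\Sigma_{\mathbf a}$ with this support. More precisely, $\Sigma_P$ is a coarsening of the fan $\Sigma_{M_\pi(P)}$, and it is the only coarsening of $\Sigma_{M_\pi(P)}$ that is a subfan of $\Sigma_{\mathbf a}$. -/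

import Mathlib

/-! ### Polymatroids and the multisymmetric lift -/

/-- A polymatroid on the finite set `E` of type `a`, given by its rank function. A polymatroid of
type `(1, …, 1)` is a matroid. -/
structure Polymatroid (E : Type*) [DecidableEq E] (a : E → ℕ) where
  rk : Finset E → ℕ
  submodular : ∀ S₁ S₂ : Finset E, rk (S₁ ∩ S₂) + rk (S₁ ∪ S₂) ≤ rk S₁ + rk S₂
  monotone : ∀ S₁ S₂ : Finset E, S₁ ⊆ S₂ → rk S₁ ≤ rk S₂
  rk_empty : rk ∅ = 0
  rk_singleton_le : ∀ i : E, rk {i} ≤ a i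

/-- A matroid on `E`: a polymatroid of type `(1, …, 1)`. -/
abbrev PolyMat (E : Type*) [DecidableEq E] := Polymatroid E (fun _ => 1)

/-- `F` is a flat if adding any element outside `F` strictly increases the rank. -/
def Polymatroid.IsFlat {E : Type*} [DecidableEq E] {a : E → ℕ} (P : Polymatroid E a)
    (F : Finset E) : Prop :=
  ∀ x ∉ F, P.rk F < P.rk (insert x F)

/-- The preimage `π⁻¹(A)`, as a finset. -/
def preim {E EE : Type*} [DecidableEq E] [Fintype EE] (π : EE → E) (A : Finset E) : Finset EE :=
  Finset.univ.filter (fun j => π j ∈ A)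

theorem exists_iInf_nat_eq {ι : Type*} [Nonempty ι] (f : ι → ℕ) : ∃ i, ⨅ j, f j = f i := by
  obtain ⟨i, hi⟩ := Nat.sInf_mem (Set.range_nonempty f)
  exact ⟨i, hi.symm⟩

/-- The multisymmetric lift `M_π(P)`: the matroid on `EE` with rank function
`S ↦ min {rk_P(A) + |S \ π⁻¹(A)| : A ⊆ E}`. -/
noncomputable def multisymmetricLift {E EE : Type*} [DecidableEq E] [Fintype EE] [DecidableEq EE]
    {a : E → ℕ} (π : EE → E) (P : Polymatroid E a) : PolyMat EE where
  rk S := ⨅ A : Finset E, (P.rk A + (S \ preim π A).card)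
  submodular S₁ S₂ := by
    obtain ⟨A, hA⟩ := exists_iInf_nat_eq (fun A : Finset E => P.rk A + (S₁ \ preim π A).card)
    obtain ⟨B, hB⟩ := exists_iInf_nat_eq (fun A : Finset E => P.rk A + (S₂ \ preim π A).card)
    have h1 := ciInf_le (OrderBot.bddBelow _ : BddBelow (Set.range
      (fun A : Finset E => P.rk A + ((S₁ ∩ S₂) \ preim π A).card))) (A ∩ B)
    have h2 := ciInf_le (OrderBot.bddBelow _ : BddBelow (Set.range
      (fun A : Finset E => P.rk A + ((S₁ ∪ S₂) \ preim π A).card))) (A ∪ B)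
    have h3 := P.submodular A B
    have h4 : ((S₁ ∩ S₂) \ preim π (A ∩ B)).card + ((S₁ ∪ S₂) \ preim π (A ∪ B)).card ≤
        (S₁ \ preim π A).card + (S₂ \ preim π B).card := by
      rw [← Finset.card_union_add_card_inter (S₁ \ preim π A) (S₂ \ preim π B),
        ← Finset.card_union_add_card_inter]
      refine Nat.add_le_add (Finset.card_le_card ?_) (Finset.card_le_card ?_) <;>
      · intro x
        simp only [preim, Finset.mem_union, Finset.mem_inter, Finset.mem_sdiff,
          Finset.mem_filter, Finset.mem_univ, true_and]
        tauto
    omega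
  monotone S₁ S₂ h := by
    refine ciInf_mono (OrderBot.bddBelow _) (fun A => ?_)
    exact Nat.add_le_add_left (Finset.card_le_card (Finset.sdiff_subset_sdiff h subset_rfl)) _
  rk_empty := by
    refine Nat.le_zero.mp ((ciInf_le (OrderBot.bddBelow _) (∅ : Finset E)).trans ?_)
    simp [P.rk_empty]
  rk_singleton_le j := by
    refine (ciInf_le (OrderBot.bddBelow _) (∅ : Finset E)).trans ?_
    rw [P.rk_empty, zero_add]
    exact (Finset.card_le_card Finset.sdiff_subset).trans (by simp)

/-! ### Fans -/

/-- A fan in `ℝ^ι`: a finite nonempty collection of strongly convex rational polyhedral cones,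
closed under taking faces, in which any two cones intersect in a common face. -/
structure IsFan {ι : Type*} (Δ : Set (PointedCone ℝ (ι → ℝ))) : Prop where
  finite : Δ.Finite
  nonempty : Δ.Nonempty
  rational : ∀ σ ∈ Δ, ∃ s : Finset (ι → ℤ),
    σ = PointedCone.hull ℝ ((fun (v : ι → ℤ) (i : ι) => (v i : ℝ)) '' (s : Set (ι → ℤ)))
  stronglyConvex : ∀ σ ∈ Δ, (σ : ConvexCone ℝ (ι → ℝ)).Salient
  face_mem : ∀ σ ∈ Δ, ∀ τ : PointedCone ℝ (ι → ℝ), τ.IsFaceOf σ → τ ∈ Δ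
  inter_face : ∀ σ ∈ Δ, ∀ τ ∈ Δ, (σ ⊓ τ).IsFaceOf σ ∧ (σ ⊓ τ).IsFaceOf τ

/-- The support of a collection of cones: the union of its cones. -/
def fanSupport {ι : Type*} (Δ : Set (PointedCone ℝ (ι → ℝ))) : Set (ι → ℝ) :=
  ⋃ σ ∈ Δ, (σ : Set (ι → ℝ))

/-- `Δ'` is a subfan of the fan `Δ`: a fan all of whose cones belong to `Δ`. -/
def IsSubfan {ι : Type*} (Δ' Δ : Set (PointedCone ℝ (ι → ℝ))) : Prop :=
  IsFan Δ ∧ IsFan Δ' ∧ Δ' ⊆ Δ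

/-- The fan `Δ` is a coarsening of the fan `Δ'` (equivalently `Δ'` refines `Δ`): they have the same
support, and every cone of `Δ'` is contained in a cone of `Δ`. -/
def IsCoarsening {ι : Type*} (Δ Δ' : Set (PointedCone ℝ (ι → ℝ))) : Prop :=
  IsFan Δ ∧ IsFan Δ' ∧ fanSupport Δ = fanSupport Δ' ∧ ∀ σ' ∈ Δ', ∃ σ ∈ Δ, σ' ≤ σ

/-! ### The polystellahedral fan and the augmented Bergman fan -/

/-- `I ≤ 𝓕` is a compatible pair with respect to `π`. The chain
`F₁ ⊊ ⋯ ⊊ F_k ⊊ F_{k+1} = E` is recorded by the finset `𝓕 = {F₁, …, F_k}` of its proper members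
(possibly empty), so that "`A ⊆ F₁`" reads "`A ⊆ F` for all `F ∈ 𝓕`". -/
structure CompatiblePair {E EE : Type*} [Fintype E] [DecidableEq E] [Fintype EE]
    (π : EE → E) (I : Finset EE) (𝓕 : Finset (Finset E)) : Prop where
  chain : IsChain (· ⊆ ·) (𝓕 : Set (Finset E))
  proper : ∀ F ∈ 𝓕, F ≠ Finset.univ
  compatible : ∀ A : Finset E, preim π A ⊆ I → ∀ F ∈ 𝓕, A ⊆ F

/-- The vector `e_S = ∑_{j ∈ S} e_j`. -/
def indVec {EE : Type*} [DecidableEq EE] (S : Finset EE) : EE → ℝ :=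
  fun j => if j ∈ S then 1 else 0

/-- The cone `σ_{I ≤ 𝓕} = cone(-e_{EE \ π⁻¹(F)} : F ∈ 𝓕) + cone(e_j : j ∈ I)`. -/
noncomputable def pairCone {E EE : Type*} [DecidableEq E] [Fintype EE] [DecidableEq EE]
    (π : EE → E) (I : Finset EE) (𝓕 : Finset (Finset E)) : PointedCone ℝ (EE → ℝ) :=
  PointedCone.hull ℝ ((fun F : Finset E => -indVec (preim π F)ᶜ) '' (𝓕 : Set (Finset E))) ⊔
    PointedCone.hull ℝ ((fun j : EE => indVec {j}) '' (I : Set EE))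

/-- The polystellahedral fan `Σ_π`. -/
def polystellahedralFan {E EE : Type*} [Fintype E] [DecidableEq E] [Fintype EE] [DecidableEq EE]
    (π : EE → E) : Set (PointedCone ℝ (EE → ℝ)) :=
  {σ | ∃ (I : Finset EE) (𝓕 : Finset (Finset E)), CompatiblePair π I 𝓕 ∧ σ = pairCone π I 𝓕}

/-- The augmented Bergman fan `Σ_P` of a polymatroid `P`: the cones `σ_{S ≤ 𝓕}` of `Σ_π`, where `𝓕`
consists of proper flats of `P`, such that `rk(π(T)) ≥ |T|` for all `T ⊆ S`, and
`rk(F ∪ π(T)) > rk(F) + |T|` for all `F ∈ 𝓕` and all nonempty `T ⊆ S \ π⁻¹(F)`. -/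
def augBergmanFan {E EE : Type*} [Fintype E] [DecidableEq E] [Fintype EE] [DecidableEq EE]
    {a : E → ℕ} (π : EE → E) (P : Polymatroid E a) : Set (PointedCone ℝ (EE → ℝ)) :=
  {σ | ∃ (S : Finset EE) (𝓕 : Finset (Finset E)), CompatiblePair π S 𝓕 ∧
    (∀ F ∈ 𝓕, P.IsFlat F) ∧
    (∀ T ⊆ S, T.card ≤ P.rk (T.image π)) ∧
    (∀ F ∈ 𝓕, ∀ T ⊆ S \ preim π F, T.Nonempty →
      P.rk F + T.card < P.rk (F ∪ T.image π)) ∧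
    σ = pairCone π S 𝓕}

/-- The augmented Bergman fan `Σ_M` of a matroid `M` on `E`, in the stellahedral fan of `E`: the
cones `σ_{I ≤ 𝓕}`, where `I` is an independent set of `M` and `𝓕` is a chain of proper flats of `M`
all of which contain `I`. -/
def matroidAugBergmanFan {E : Type*} [Fintype E] [DecidableEq E] (M : PolyMat E) :
    Set (PointedCone ℝ (E → ℝ)) :=
  {σ | ∃ (I : Finset E) (𝓕 : Finset (Finset E)), M.rk I = I.card ∧
    IsChain (· ⊆ ·) (𝓕 : Set (Finset E)) ∧ (∀ F ∈ 𝓕, F ≠ Finset.univ ∧ M.IsFlat F ∧ I ⊆ F) ∧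
    σ = pairCone id I 𝓕}

theorem PolyMat.rk_union_le {E : Type*} [DecidableEq E] (M : PolyMat E) (F T : Finset E) :
    M.rk (F ∪ T) ≤ M.rk F + T.card := by
  induction T using Finset.induction_on with
  | empty => simp
  | insert x T hx ih =>
    have h := M.submodular (F ∪ T) {x}
    have hx1 := M.rk_singleton_le x
    have e : F ∪ T ∪ {x} = F ∪ insert x T := by
      ext y; simp only [Finset.mem_union, Finset.mem_singleton, Finset.mem_insert]; tauto
    rw [e] at h
    rw [Finset.card_insert_of_notMem hx]
    omega

/-- For a matroid, viewed as a polymatroid of type `(1, …, 1)` with `π` the identity, the two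
definitions of the augmented Bergman fan agree. -/
theorem matroidAugBergmanFan_eq {E : Type*} [Fintype E] [DecidableEq E] (M : PolyMat E) :
    matroidAugBergmanFan M = augBergmanFan id M := by
  ext σ
  constructor
  · rintro ⟨I, 𝓕, hI, hc, hF, rfl⟩
    refine ⟨I, 𝓕, ⟨hc, fun F h => (hF F h).1, fun A hA F h => ?_⟩, fun F h => (hF F h).2.1,
      fun T hT => ?_, fun F h T hT hne => ?_, rfl⟩
    · intro x hx
      exact (hF F h).2.2 (hA (by simpa [preim] using hx))
    · have h1 := M.rk_union_le T (I \ T)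
      rw [Finset.union_sdiff_of_subset hT, hI, Finset.card_sdiff_of_subset hT] at h1
      have := Finset.card_le_card hT
      rw [Finset.image_id]
      omega
    · exfalso
      obtain ⟨x, hx⟩ := hne
      have h1 := Finset.mem_sdiff.mp (hT hx)
      exact h1.2 (by simpa [preim] using (hF F h).2.2 h1.1)
  · rintro ⟨I, 𝓕, hc, hfl, h1, h2, rfl⟩
    refine ⟨I, 𝓕, le_antisymm ?_ ?_, hc.chain, fun F h => ⟨hc.proper F h, hfl F h, ?_⟩, rfl⟩
    · simpa [M.rk_empty] using M.rk_union_le ∅ I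
    · simpa using h1 I subset_rfl
    · exact hc.compatible I (by intro x; simp [preim]) F h

/-! Every vector `x` has a normal form relative to `π`. Let `y i` be the minimum of `0` and of `x`
on the fibre over `i`, let `S` be the set of `j` with `x j > y (π j)`, and let `𝓕` consist of the
superlevel sets of `y` at its negative values. A compatible cone contains `x` exactly when its pair
contains `(S, 𝓕)` (`CompatiblePair.mem_pairCone_iff`). Faces and intersections of cones thus become
inclusions and intersections of pairs, and a subfan of `Σ_π` is determined by its support
(`eq_of_fanSupport_eq`).

For the supports, the normal forms of `x` relative to `π` and to `id` are compared. A set `G` is a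
flat of the lift iff the set `A` of indices whose whole fibre lies in `G` is a flat of `P` and the
strict rank condition holds over `A` on `G \ π⁻¹(A)` (`multisymmetricLift_isFlat_iff`). For
superlevel sets of `x` at `t < 0`, `A` is the superlevel set of `y`. The conditions on the two
normal forms are then equivalent (`isBergmanPair_support_iff`). Coarsening holds because the
`π`-normal form is monotone in the `id`-normal form. -/

set_option linter.unusedSectionVars false

/-! ### Normal forms of vectors and membership in cones -/

section Geometry

open Finset

variable {E EE : Type*} [Fintype E] [DecidableEq E] [Fintype EE] [DecidableEq EE]

@[simp] theorem mem_preim (π : EE → E) (A : Finset E) (j : EE) : j ∈ preim π A ↔ π j ∈ A := by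
  simp [preim]

/-- The minimum of `0` and of the values of `x` on the fibre of `π` over `i`. -/
def fiberFloor (π : EE → E) (x : EE → ℝ) (i : E) : ℝ :=
  (univ.filter (fun j => π j = i)).fold min 0 x

theorem lt_fiberFloor {π : EE → E} {x : EE → ℝ} {i : E} {c : ℝ} :
    c < fiberFloor π x i ↔ c < 0 ∧ ∀ j, π j = i → c < x j := by
  simp [fiberFloor, lt_fold_min]

theorem le_fiberFloor {π : EE → E} {x : EE → ℝ} {i : E} {c : ℝ} :
    c ≤ fiberFloor π x i ↔ c ≤ 0 ∧ ∀ j, π j = i → c ≤ x j := by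
  simp [fiberFloor, le_fold_min]

theorem fiberFloor_nonpos (π : EE → E) (x : EE → ℝ) (i : E) : fiberFloor π x i ≤ 0 :=
  (le_fiberFloor.1 le_rfl).1

theorem fiberFloor_le (π : EE → E) (x : EE → ℝ) (j : EE) : fiberFloor π x (π j) ≤ x j :=
  (le_fiberFloor.1 le_rfl).2 j rfl

theorem exists_eq_fiberFloor {π : EE → E} {x : EE → ℝ} {i : E} (h : fiberFloor π x i < 0) :
    ∃ j, π j = i ∧ x j = fiberFloor π x i := by
  by_contra! H
  refine lt_irrefl (fiberFloor π x i) (lt_fiberFloor.2 ⟨h, fun j hj => ?_⟩)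
  subst hj
  exact lt_of_le_of_ne (fiberFloor_le π x j) (H j rfl).symm

theorem fiberFloor_id (x : EE → ℝ) (j : EE) : fiberFloor id x j = min 0 (x j) := by
  refine le_antisymm (le_min (fiberFloor_nonpos _ _ _) (fiberFloor_le id x j)) ?_
  refine le_fiberFloor.2 ⟨min_le_left _ _, fun k hk => ?_⟩
  rw [show k = j from hk]
  exact min_le_right _ _

/-- The proper strict superlevel sets of a function at its negative values. -/
noncomputable def levelChain (y : E → ℝ) : Finset (Finset E) :=
  (univ.filter (fun i => y i < 0)).image (fun i => univ.filter (fun k => y i < y k))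

theorem mem_levelChain {y : E → ℝ} {F : Finset E} :
    F ∈ levelChain y ↔ ∃ i, y i < 0 ∧ univ.filter (fun k => y i < y k) = F := by
  simp [levelChain]

/-- The elements at which `x` exceeds the floor of the fibre. -/
noncomputable def supportSet (π : EE → E) (x : EE → ℝ) : Finset EE :=
  univ.filter (fun j => fiberFloor π x (π j) < x j)

@[simp] theorem mem_supportSet {π : EE → E} {x : EE → ℝ} {j : EE} :
    j ∈ supportSet π x ↔ fiberFloor π x (π j) < x j := by
  simp [supportSet]

/-- The chain of superlevel sets of the fibre floors of `x`. -/
noncomputable def supportChain (π : EE → E) (x : EE → ℝ) : Finset (Finset E) :=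
  levelChain (fiberFloor π x)

theorem CompatiblePair.mono {π : EE → E} {I I' : Finset EE} {𝓕 𝓕' : Finset (Finset E)}
    (h : CompatiblePair π I 𝓕) (hI : I' ⊆ I) (hF : 𝓕' ⊆ 𝓕) : CompatiblePair π I' 𝓕' where
  chain := h.chain.mono (by exact_mod_cast hF)
  proper F hF' := h.proper F (hF hF')
  compatible A hA F hF' := h.compatible A (hA.trans hI) F (hF hF')

/-- A fibre with negative floor contains a minimiser of `x`, which is not in the support set. So a
fibre inside the support set has floor `0`, and its index lies in every level set. -/
theorem compatiblePair_support (π : EE → E) (x : EE → ℝ) :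
    CompatiblePair π (supportSet π x) (supportChain π x) where
  chain := by
    intro F hF G hG _
    obtain ⟨i, -, rfl⟩ := mem_levelChain.1 (mem_coe.1 hF)
    obtain ⟨k, -, rfl⟩ := mem_levelChain.1 (mem_coe.1 hG)
    rcases le_total (fiberFloor π x i) (fiberFloor π x k) with h | h
    · right
      intro l hl
      simp only [mem_filter, mem_univ, true_and] at hl ⊢
      exact h.trans_lt hl
    · left
      intro l hl
      simp only [mem_filter, mem_univ, true_and] at hl ⊢
      exact h.trans_lt hl
  proper F hF := by
    obtain ⟨i, -, rfl⟩ := mem_levelChain.1 hF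
    intro h
    have := h ▸ mem_univ i
    simp at this
  compatible A hA F hF := by
    obtain ⟨i, hi, rfl⟩ := mem_levelChain.1 hF
    intro k hk
    simp only [mem_filter, mem_univ, true_and]
    by_contra! hle
    obtain ⟨j, rfl, hj⟩ := exists_eq_fiberFloor (hle.trans_lt hi)
    have := mem_supportSet.1 (hA ((mem_preim π A j).2 hk))
    exact this.ne' hj

/-- The combination of the generators of `pairCone π I 𝓕` with the given coefficients. -/
def pairSum (π : EE → E) (I : Finset EE) (𝓕 : Finset (Finset E)) (c : Finset E → ℝ)
    (b : EE → ℝ) : EE → ℝ :=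
  ∑ F ∈ 𝓕, c F • (-indVec (preim π F)ᶜ) + ∑ j ∈ I, b j • indVec {j}

theorem mem_pairCone {π : EE → E} {I : Finset EE} {𝓕 : Finset (Finset E)} {x : EE → ℝ} :
    x ∈ pairCone π I 𝓕 ↔
      ∃ (c : Finset E → ℝ) (b : EE → ℝ), 0 ≤ c ∧ 0 ≤ b ∧ x = pairSum π I 𝓕 c b := by
  rw [pairCone, Submodule.mem_sup]
  constructor
  · rintro ⟨u, hu, v, hv, rfl⟩
    obtain ⟨c, rfl⟩ := (Submodule.mem_span_image_finset_iff_exists_fun' _).1 hu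
    obtain ⟨b, rfl⟩ := (Submodule.mem_span_image_finset_iff_exists_fun' _).1 hv
    exact ⟨fun F => c F, fun j => b j, fun F => (c F).2, fun j => (b j).2, rfl⟩
  · rintro ⟨c, b, hc, hb, rfl⟩
    refine ⟨_, (Submodule.mem_span_image_finset_iff_exists_fun' _).2
      ⟨fun F => ⟨c F, hc F⟩, rfl⟩, _, (Submodule.mem_span_image_finset_iff_exists_fun' _).2
      ⟨fun j => ⟨b j, hb j⟩, rfl⟩, rfl⟩

theorem pairSum_apply (π : EE → E) (I : Finset EE) (𝓕 : Finset (Finset E)) (c : Finset E → ℝ)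
    (b : EE → ℝ) (j : EE) :
    pairSum π I 𝓕 c b j =
      -(∑ F ∈ 𝓕 with π j ∉ F, c F) + if j ∈ I then b j else 0 := by
  rw [pairSum, Pi.add_apply, Finset.sum_apply, Finset.sum_apply]
  congr 1
  · rw [sum_filter, ← sum_neg_distrib]
    refine sum_congr rfl fun F _ => ?_
    by_cases h : π j ∈ F <;> simp [indVec, h]
  · simp [indVec]

/-- If some member of `𝓕` omits `i`, compatibility gives an element of the fibre outside `I`, and it
attains the value. Otherwise the sum is empty and the default `0` is the minimum. -/
theorem fiberFloor_pairSum {π : EE → E} {I : Finset EE} {𝓕 : Finset (Finset E)}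
    (h : CompatiblePair π I 𝓕) {c : Finset E → ℝ} {b : EE → ℝ} (hc : 0 ≤ c) (hb : 0 ≤ b) (i : E) :
    fiberFloor π (pairSum π I 𝓕 c b) i = -(∑ F ∈ 𝓕 with i ∉ F, c F) := by
  have h0 : 0 ≤ ∑ F ∈ 𝓕 with i ∉ F, c F := sum_nonneg fun F _ => hc F
  refine le_antisymm ?_ (le_fiberFloor.2 ⟨by linarith, fun j hj => ?_⟩)
  · by_cases hi : ∃ F ∈ 𝓕, i ∉ F
    · obtain ⟨F, hF, hiF⟩ := hi
      have : ¬ preim π {i} ⊆ I := fun H => hiF (h.compatible {i} H F hF (mem_singleton_self i))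
      obtain ⟨j, hj, hjI⟩ := not_subset.1 this
      have hj' : π j = i := by simpa using hj
      subst hj'
      refine (fiberFloor_le _ _ j).trans ?_
      simp [pairSum_apply, hjI]
    · push Not at hi
      rw [filter_false_of_mem (fun F hF => not_not.2 (hi F hF))]
      simpa using fiberFloor_nonpos _ _ _
  · subst hj
    rw [pairSum_apply]
    split_ifs
    · have := hb j
      simp only [Pi.zero_apply] at this
      linarith
    · simp

theorem supportSet_pairSum {π : EE → E} {I : Finset EE} {𝓕 : Finset (Finset E)}
    (h : CompatiblePair π I 𝓕) {c : Finset E → ℝ} {b : EE → ℝ} (hc : 0 ≤ c) (hb : 0 ≤ b) :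
    supportSet π (pairSum π I 𝓕 c b) = I.filter (fun j => 0 < b j) := by
  ext j
  rw [mem_supportSet, fiberFloor_pairSum h hc hb, pairSum_apply, mem_filter]
  split_ifs with hj <;> simp [hj]

theorem CompatiblePair.subset_of_mem {π : EE → E} {I : Finset EE} {𝓕 : Finset (Finset E)}
    (h : CompatiblePair π I 𝓕) {F G : Finset E} (hF : F ∈ 𝓕) (hG : G ∈ 𝓕) {i : E}
    (hi : i ∈ F) (hi' : i ∉ G) : G ⊆ F :=
  (h.chain.total (mem_coe.2 hF) (mem_coe.2 hG)).resolve_left fun H => hi' (H hi)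

theorem supportChain_pairSum {π : EE → E} {I : Finset EE} {𝓕 : Finset (Finset E)}
    (h : CompatiblePair π I 𝓕) {c : Finset E → ℝ} {b : EE → ℝ} (hc : 0 ≤ c) (hb : 0 ≤ b) :
    supportChain π (pairSum π I 𝓕 c b) = 𝓕.filter (fun F => 0 < c F) := by
  have step : ∀ F ∈ 𝓕, 0 < c F → ∀ i ∉ F, ∀ k ∈ F,
      ∑ G ∈ 𝓕 with k ∉ G, c G < ∑ G ∈ 𝓕 with i ∉ G, c G := by
    intro F hF hcF i hi k hk
    refine sum_lt_sum_of_subset (i := F) (fun G hG => ?_) (by simp [hF, hi]) (by simp [hk]) hcF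
      fun G _ _ => hc G
    rw [mem_filter] at hG ⊢
    exact ⟨hG.1, fun hiG => hi (h.subset_of_mem hF hG.1 hk hG.2 hiG)⟩
  ext F
  simp only [supportChain, mem_levelChain, fiberFloor_pairSum h hc hb, neg_lt_neg_iff, mem_filter,
    Left.neg_neg_iff]
  constructor
  · rintro ⟨i, hi, rfl⟩
    have hne : (𝓕.filter fun F => i ∉ F ∧ 0 < c F).Nonempty := by
      by_contra hne
      rw [not_nonempty_iff_eq_empty, filter_eq_empty_iff] at hne
      refine hi.not_ge (sum_nonpos fun F hF => ?_)
      rw [mem_filter] at hF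
      by_contra! hlt
      exact hne hF.1 ⟨hF.2, hlt⟩
    -- The largest positive-weight member omitting `i` contains all the others, so it is the level
    -- set at `i`.
    obtain ⟨F, hF, hmax⟩ := exists_max_image _ card hne
    simp only [mem_filter] at hF hmax
    have key : univ.filter (fun k => ∑ G ∈ 𝓕 with k ∉ G, c G < ∑ G ∈ 𝓕 with i ∉ G, c G) = F := by
      ext k
      simp only [mem_filter, mem_univ, true_and]
      refine ⟨fun hk => ?_, fun hk => step F hF.1 hF.2.2 i hF.2.1 k hk⟩
      by_contra hkF
      refine hk.not_ge ?_
      rw [sum_filter, sum_filter]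
      refine sum_le_sum fun G hG => ?_
      by_cases h2 : k ∈ G
      · rw [if_neg (not_not.2 h2)]
        split_ifs with h1
        · exact le_rfl
        · by_contra! hlt
          rcases h.chain.total (mem_coe.2 hF.1) (mem_coe.2 hG) with hs | hs
          · rw [← eq_of_subset_of_card_le hs (hmax G ⟨hG, h1, hlt⟩)] at h2
            exact hkF h2
          · exact hkF (hs h2)
      · rw [if_pos h2]
        split_ifs
        · exact hc G
        · exact le_rfl
    rw [key]
    exact ⟨hF.1, hF.2.2⟩
  · rintro ⟨hF, hcF⟩
    have hne : (univ.filter fun i => i ∉ F).Nonempty := by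
      by_contra hne
      rw [not_nonempty_iff_eq_empty, filter_eq_empty_iff] at hne
      exact h.proper F hF (eq_univ_of_forall fun i => not_not.1 (hne (mem_univ i)))
    -- Outside `F`, take an index of highest floor: whatever lies strictly above it is in `F`.
    obtain ⟨i, hi, hmin⟩ := exists_min_image _ (fun i => ∑ G ∈ 𝓕 with i ∉ G, c G) hne
    simp only [mem_filter, mem_univ, true_and] at hi hmin
    refine ⟨i, lt_of_lt_of_le hcF (single_le_sum (f := c) (fun G _ => hc G) (by simp [hF, hi])), ?_⟩
    ext k
    simp only [mem_filter, mem_univ, true_and]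
    exact ⟨fun hk => by_contra fun hkF => hk.not_ge (hmin k hkF),
      fun hk => step F hF hcF i hi k hk⟩

theorem pairCone_mono {π : EE → E} {I I' : Finset EE} {𝓕 𝓕' : Finset (Finset E)}
    (hI : I' ⊆ I) (hF : 𝓕' ⊆ 𝓕) : pairCone π I' 𝓕' ≤ pairCone π I 𝓕 :=
  sup_le_sup (Submodule.span_mono (Set.image_mono (by exact_mod_cast hF)))
    (Submodule.span_mono (Set.image_mono (by exact_mod_cast hI)))

/-- Peel off the largest negative value `y m`: the generator of `{y > y m}` with coefficient `-y m`
leaves a function `z` with fewer negative entries, whose level sets are already level sets of `y`.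
-/
theorem comp_mem_hull_levelChain (π : EE → E) (y : E → ℝ) (hy : ∀ i, y i ≤ 0) :
    (fun j => y (π j)) ∈ PointedCone.hull ℝ ((fun F : Finset E => -indVec (preim π F)ᶜ) ''
      (levelChain y : Set (Finset E))) := by
  induction hn : (univ.filter (fun i => y i < 0)).card using Nat.strong_induction_on
    generalizing y with
  | _ n ih =>
    subst hn
    by_cases hne : (univ.filter (fun i => y i < 0)).Nonempty
    · obtain ⟨m, hm, hmax⟩ := exists_max_image _ y hne
      simp only [mem_filter, mem_univ, true_and] at hm hmax
      have hzero : ∀ i, y m < y i → y i = 0 := fun i hi =>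
        (hy i).antisymm (not_lt.1 fun h => (hmax i h).not_gt hi)
      set z : E → ℝ := fun i => if y m < y i then 0 else y i - y m with hz
      have hz0 : ∀ i, z i ≤ 0 := by
        intro i
        simp only [hz]
        split_ifs with h
        · exact le_rfl
        · linarith
      have hzneg : ∀ i, z i < 0 ↔ y i < y m := by
        intro i
        simp only [hz]
        split_ifs with h
        · simp [h.le]
        · exact sub_neg
      have hcard : (univ.filter (fun i => z i < 0)).card <
          (univ.filter (fun i => y i < 0)).card := by
        refine card_lt_card ⟨fun i hi => ?_, fun H => ?_⟩
        · simp only [mem_filter, mem_univ, true_and, hzneg] at hi ⊢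
          exact hi.trans hm
        · have := H (x := m) (by simpa using hm)
          simp [hzneg] at this
      have hsub : levelChain z ⊆ levelChain y := by
        intro F hF
        obtain ⟨i, hi, rfl⟩ := mem_levelChain.1 hF
        have hi' := (hzneg i).1 hi
        refine mem_levelChain.2 ⟨i, hi'.trans hm, ?_⟩
        ext k
        have h1 : z i = y i - y m := if_neg hi'.not_gt
        simp only [mem_filter, mem_univ, true_and, h1]
        by_cases hk : y m < y k
        · have : z k = 0 := if_pos hk
          rw [this]
          exact ⟨fun _ => sub_neg.2 hi', fun _ => hi'.trans hk⟩
        · have : z k = y k - y m := if_neg hk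
          rw [this]
          exact (sub_lt_sub_iff_right _).symm
      have h1 := Submodule.span_mono (Set.image_mono (by exact_mod_cast hsub))
        (ih _ hcard z hz0 rfl)
      have h2 : -indVec (preim π (univ.filter (fun k => y m < y k)))ᶜ ∈
          PointedCone.hull ℝ ((fun F : Finset E => -indVec (preim π F)ᶜ) ''
            (levelChain y : Set (Finset E))) :=
        Submodule.subset_span ⟨_, mem_coe.2 (mem_levelChain.2 ⟨m, hm, rfl⟩), rfl⟩
      have h3 := Submodule.add_mem _ h1 (PointedCone.smul_mem _ (neg_nonneg.2 hm.le) h2)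
      convert h3 using 1
      ext j
      by_cases hj : y m < y (π j)
      · have : z (π j) = 0 := if_pos hj
        simp [indVec, this, hzero _ hj, hm]
      · have : z (π j) = y (π j) - y m := if_neg hj
        simp [indVec, this, hj]
    · rw [not_nonempty_iff_eq_empty, filter_eq_empty_iff] at hne
      have : (fun j => y (π j)) = 0 := by
        ext j
        exact (hy _).antisymm (not_lt.1 (hne (mem_univ _)))
      rw [this]
      exact Submodule.zero_mem _

theorem mem_pairCone_support (π : EE → E) (x : EE → ℝ) :
    x ∈ pairCone π (supportSet π x) (supportChain π x) := by
  refine Submodule.mem_sup.2 ⟨_, comp_mem_hull_levelChain π _ (fiberFloor_nonpos π x),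
    ∑ j ∈ supportSet π x, (x j - fiberFloor π x (π j)) • indVec {j},
    Submodule.sum_mem _ fun j hj => PointedCone.smul_mem _ ?_
      (Submodule.subset_span ⟨j, mem_coe.2 hj, rfl⟩), ?_⟩
  · exact sub_nonneg.2 (fiberFloor_le π x j)
  · ext j
    rw [Pi.add_apply, Finset.sum_apply]
    have h : ∑ k ∈ supportSet π x, ((x k - fiberFloor π x (π k)) • indVec {k} : EE → ℝ) j =
        if j ∈ supportSet π x then x j - fiberFloor π x (π j) else 0 := by
      simp [indVec]
    rw [h]
    split_ifs with hj
    · ring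
    · rw [mem_supportSet, not_lt] at hj
      rw [add_zero]
      exact (fiberFloor_le π x j).antisymm hj

/-- The normal form of a nonnegative combination records exactly the generators with positive
coefficient. Hence geometry reduces to inclusions of finite sets. -/
theorem CompatiblePair.mem_pairCone_iff {π : EE → E} {I : Finset EE} {𝓕 : Finset (Finset E)}
    (h : CompatiblePair π I 𝓕) {x : EE → ℝ} :
    x ∈ pairCone π I 𝓕 ↔ supportSet π x ⊆ I ∧ supportChain π x ⊆ 𝓕 := by
  refine ⟨fun hx => ?_, fun hx => pairCone_mono hx.1 hx.2 (mem_pairCone_support π x)⟩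
  obtain ⟨c, b, hc, hb, rfl⟩ := mem_pairCone.1 hx
  rw [supportSet_pairSum h hc hb, supportChain_pairSum h hc hb]
  exact ⟨filter_subset _ _, filter_subset _ _⟩

theorem CompatiblePair.exists_support_eq {π : EE → E} {I : Finset EE} {𝓕 : Finset (Finset E)}
    (h : CompatiblePair π I 𝓕) : ∃ x, supportSet π x = I ∧ supportChain π x = 𝓕 :=
  ⟨pairSum π I 𝓕 1 1, by simp [supportSet_pairSum h zero_le_one zero_le_one],
    by simp [supportChain_pairSum h zero_le_one zero_le_one]⟩

/-! ### Faces, fan axioms and uniqueness of subfans -/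

theorem CompatiblePair.inf_pairCone {π : EE → E} {I I' : Finset EE} {𝓕 𝓕' : Finset (Finset E)}
    (h : CompatiblePair π I 𝓕) (h' : CompatiblePair π I' 𝓕') :
    pairCone π I 𝓕 ⊓ pairCone π I' 𝓕' = pairCone π (I ∩ I') (𝓕 ∩ 𝓕') := by
  ext x
  rw [Submodule.mem_inf, h.mem_pairCone_iff, h'.mem_pairCone_iff,
    (h.mono inter_subset_left inter_subset_left).mem_pairCone_iff, subset_inter_iff,
    subset_inter_iff]
  tauto

theorem smul_pairSum_add_pairSum (π : EE → E) (I : Finset EE) (𝓕 : Finset (Finset E)) (t : ℝ)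
    (c c' : Finset E → ℝ) (b b' : EE → ℝ) :
    t • pairSum π I 𝓕 c b + pairSum π I 𝓕 c' b' =
      pairSum π I 𝓕 (t • c + c') (t • b + b') := by
  ext j
  simp only [Pi.add_apply, Pi.smul_apply, pairSum_apply, smul_eq_mul, sum_add_distrib, ← mul_sum]
  split_ifs <;> ring

/-- Coefficients are nonnegative, so a generator used by `x` cannot cancel in `t • x + y`. -/
theorem CompatiblePair.isFaceOf {π : EE → E} {I I' : Finset EE} {𝓕 𝓕' : Finset (Finset E)}
    (h : CompatiblePair π I 𝓕) (hI : I' ⊆ I) (hF : 𝓕' ⊆ 𝓕) :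
    (pairCone π I' 𝓕').IsFaceOf (pairCone π I 𝓕) where
  le := pairCone_mono hI hF
  mem_of_smul_add_mem := by
    intro x y t hx hy ht hxy
    obtain ⟨c, b, hc, hb, rfl⟩ := mem_pairCone.1 hx
    obtain ⟨c', b', hc', hb', rfl⟩ := mem_pairCone.1 hy
    have hc'' : 0 ≤ t • c + c' := add_nonneg (smul_nonneg ht.le hc) hc'
    have hb'' : 0 ≤ t • b + b' := add_nonneg (smul_nonneg ht.le hb) hb'
    rw [smul_pairSum_add_pairSum, (h.mono hI hF).mem_pairCone_iff, supportSet_pairSum h hc'' hb'',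
      supportChain_pairSum h hc'' hb''] at hxy
    rw [(h.mono hI hF).mem_pairCone_iff, supportSet_pairSum h hc hb, supportChain_pairSum h hc hb]
    refine ⟨fun j hj => hxy.1 ?_, fun F hF => hxy.2 ?_⟩
    · rw [mem_filter] at hj ⊢
      exact ⟨hj.1, add_pos_of_pos_of_nonneg (mul_pos ht hj.2) (hb' j)⟩
    · rw [mem_filter] at hF ⊢
      exact ⟨hF.1, add_pos_of_pos_of_nonneg (mul_pos ht hF.2) (hc' F)⟩

/-- A face is spanned by the generators it contains: splitting one positive term off a point of the
face forces its generator into the face. -/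
theorem eq_pairCone_of_isFaceOf {π : EE → E} {I : Finset EE} {𝓕 : Finset (Finset E)}
    {τ : PointedCone ℝ (EE → ℝ)} (h : τ.IsFaceOf (pairCone π I 𝓕)) :
    ∃ I' ⊆ I, ∃ 𝓕' ⊆ 𝓕, τ = pairCone π I' 𝓕' := by
  classical
  refine ⟨I.filter fun j => indVec {j} ∈ τ, filter_subset _ _,
    𝓕.filter fun F => -indVec (preim π F)ᶜ ∈ τ, filter_subset _ _, le_antisymm ?_ ?_⟩
  · intro x hx
    obtain ⟨c, b, hc, hb, rfl⟩ := mem_pairCone.1 (h.le hx)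
    have hgF : ∀ F ∈ 𝓕, -indVec (preim π F)ᶜ ∈ pairCone π I 𝓕 := fun F hF =>
      Submodule.mem_sup_left (Submodule.subset_span ⟨F, mem_coe.2 hF, rfl⟩)
    have hgI : ∀ j ∈ I, indVec {j} ∈ pairCone π I 𝓕 := fun j hj =>
      Submodule.mem_sup_right (Submodule.subset_span ⟨j, mem_coe.2 hj, rfl⟩)
    have hsF : ∀ s ⊆ 𝓕, ∑ F ∈ s, c F • (-indVec (preim π F)ᶜ) ∈ pairCone π I 𝓕 := fun s hs =>
      Submodule.sum_mem _ fun F hF => PointedCone.smul_mem _ (hc F) (hgF F (hs hF))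
    have hsI : ∀ s ⊆ I, ∑ j ∈ s, b j • indVec {j} ∈ pairCone π I 𝓕 := fun s hs =>
      Submodule.sum_mem _ fun j hj => PointedCone.smul_mem _ (hb j) (hgI j (hs hj))
    refine Submodule.add_mem _ (Submodule.sum_mem _ fun F hF => ?_)
      (Submodule.sum_mem _ fun j hj => ?_)
    · rcases (hc F).lt_or_eq with hlt | heq
      · refine PointedCone.smul_mem _ (hc F) (Submodule.mem_sup_left (Submodule.subset_span
          ⟨F, mem_coe.2 (mem_filter.2 ⟨hF, ?_⟩), rfl⟩))
        refine h.mem_of_smul_add_mem (hgF F hF) (Submodule.add_mem _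
          (hsF _ (erase_subset F 𝓕)) (hsI I subset_rfl)) hlt ?_
        rw [← add_assoc, add_sum_erase 𝓕 (fun F => c F • (-indVec (preim π F)ᶜ)) hF]
        exact hx
      · have : c F = 0 := heq.symm
        rw [this, zero_smul]
        exact Submodule.zero_mem _
    · rcases (hb j).lt_or_eq with hlt | heq
      · refine PointedCone.smul_mem _ (hb j) (Submodule.mem_sup_right (Submodule.subset_span
          ⟨j, mem_coe.2 (mem_filter.2 ⟨hj, ?_⟩), rfl⟩))
        refine h.mem_of_smul_add_mem (hgI j hj) (Submodule.add_mem _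
          (hsF 𝓕 subset_rfl) (hsI _ (erase_subset j I))) hlt ?_
        rw [add_left_comm, add_sum_erase I (fun j => b j • indVec {j}) hj]
        exact hx
      · have : b j = 0 := heq.symm
        rw [this, zero_smul]
        exact Submodule.zero_mem _
  · refine sup_le (Submodule.span_le.2 ?_) (Submodule.span_le.2 ?_) <;>
    · rintro _ ⟨_, hF, rfl⟩
      exact (mem_filter.1 (mem_coe.1 hF)).2

theorem CompatiblePair.salient {π : EE → E} {I : Finset EE} {𝓕 : Finset (Finset E)}
    (h : CompatiblePair π I 𝓕) : (pairCone π I 𝓕 : ConvexCone ℝ (EE → ℝ)).Salient := by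
  intro x hx hne hx'
  refine hne ?_
  have h0 : CompatiblePair π ∅ ∅ := h.mono (empty_subset _) (empty_subset _)
  have hf := h.isFaceOf (empty_subset I) (empty_subset 𝓕)
  have := hf.mem_of_smul_add_mem (x := x) (y := -x) hx hx' one_pos
    (by rw [one_smul, add_neg_cancel]; exact Submodule.zero_mem _)
  simpa [pairCone] using this

theorem pairCone_rational (π : EE → E) (I : Finset EE) (𝓕 : Finset (Finset E)) :
    ∃ s : Finset (EE → ℤ), pairCone π I 𝓕 =
      PointedCone.hull ℝ ((fun (v : EE → ℤ) (i : EE) => (v i : ℝ)) '' (s : Set (EE → ℤ))) := by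
  classical
  refine ⟨𝓕.image (fun F j => if j ∈ (preim π F)ᶜ then -1 else 0) ∪
    I.image (fun i j => if j ∈ ({i} : Finset EE) then 1 else 0), ?_⟩
  rw [pairCone, PointedCone.hull, PointedCone.hull, PointedCone.hull, ← Submodule.span_union,
    coe_union, coe_image, coe_image, Set.image_union, Set.image_image, Set.image_image]
  congr 3
  · ext F j
    by_cases hj : j ∈ (preim π F)ᶜ <;> simp only [indVec, Pi.neg_apply, hj] <;> simp
  · ext i j
    simp [indVec]

/-- Applied to the compatible pairs and to the Bergman pairs, both stable under shrinking. -/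
theorem isFan_of_downClosed {π : EE → E} (Q : Finset EE → Finset (Finset E) → Prop)
    (hQ : ∀ I 𝓕, Q I 𝓕 → CompatiblePair π I 𝓕) (hQ0 : Q ∅ ∅)
    (hmono : ∀ I 𝓕 I' 𝓕', Q I 𝓕 → I' ⊆ I → 𝓕' ⊆ 𝓕 → Q I' 𝓕') :
    IsFan {σ | ∃ I 𝓕, Q I 𝓕 ∧ σ = pairCone π I 𝓕} where
  finite := by
    refine (Set.finite_range fun p : Finset EE × Finset (Finset E) =>
      pairCone π p.1 p.2).subset ?_
    rintro _ ⟨I, 𝓕, -, rfl⟩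
    exact ⟨(I, 𝓕), rfl⟩
  nonempty := ⟨_, ∅, ∅, hQ0, rfl⟩
  rational := by
    rintro _ ⟨I, 𝓕, -, rfl⟩
    exact pairCone_rational π I 𝓕
  stronglyConvex := by
    rintro _ ⟨I, 𝓕, h, rfl⟩
    exact (hQ I 𝓕 h).salient
  face_mem := by
    rintro _ ⟨I, 𝓕, h, rfl⟩ τ hτ
    obtain ⟨I', hI, 𝓕', hF, rfl⟩ := eq_pairCone_of_isFaceOf hτ
    exact ⟨I', 𝓕', hmono _ _ _ _ h hI hF, rfl⟩
  inter_face := by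
    rintro _ ⟨I, 𝓕, h, rfl⟩ _ ⟨I', 𝓕', h', rfl⟩
    rw [(hQ I 𝓕 h).inf_pairCone (hQ I' 𝓕' h')]
    exact ⟨(hQ I 𝓕 h).isFaceOf inter_subset_left inter_subset_left,
      (hQ I' 𝓕' h').isFaceOf inter_subset_right inter_subset_right⟩

theorem mem_fanSupport_of_downClosed {π : EE → E} (Q : Finset EE → Finset (Finset E) → Prop)
    (hQ : ∀ I 𝓕, Q I 𝓕 → CompatiblePair π I 𝓕)
    (hmono : ∀ I 𝓕 I' 𝓕', Q I 𝓕 → I' ⊆ I → 𝓕' ⊆ 𝓕 → Q I' 𝓕') {x : EE → ℝ} :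
    x ∈ fanSupport {σ | ∃ I 𝓕, Q I 𝓕 ∧ σ = pairCone π I 𝓕} ↔
      Q (supportSet π x) (supportChain π x) := by
  simp only [fanSupport, Set.mem_iUnion, Set.mem_ofPred_eq, SetLike.mem_coe, exists_prop]
  constructor
  · rintro ⟨_, ⟨I, 𝓕, h, rfl⟩, hx⟩
    rw [(hQ I 𝓕 h).mem_pairCone_iff] at hx
    exact hmono _ _ _ _ h hx.1 hx.2
  · exact fun h => ⟨_, ⟨_, _, h, rfl⟩, mem_pairCone_support π x⟩

theorem isFan_polystellahedralFan (π : EE → E) : IsFan (polystellahedralFan π) :=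
  isFan_of_downClosed (CompatiblePair π) (fun _ _ h => h)
    ⟨by simp, by simp, by simp⟩ (fun _ _ _ _ h hI hF => h.mono hI hF)

/-- Take a point of a cone of `Δ` with that cone's full pair as normal form. Any cone of `Δ'`
through this point has a larger pair, so the given cone is a face of it. -/
theorem subset_of_fanSupport_subset {π : EE → E} {Δ Δ' : Set (PointedCone ℝ (EE → ℝ))}
    (h : Δ ⊆ polystellahedralFan π) (h' : Δ' ⊆ polystellahedralFan π) (hΔ' : IsFan Δ')
    (hs : fanSupport Δ ⊆ fanSupport Δ') : Δ ⊆ Δ' := by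
  intro σ hσ
  obtain ⟨I, 𝓕, hc, rfl⟩ := h hσ
  obtain ⟨x, rfl, rfl⟩ := hc.exists_support_eq
  have hx : x ∈ fanSupport Δ' := hs (Set.mem_biUnion hσ (mem_pairCone_support π x))
  simp only [fanSupport, Set.mem_iUnion, SetLike.mem_coe, exists_prop] at hx
  obtain ⟨τ, hτ, hxτ⟩ := hx
  obtain ⟨I', 𝓕', hc', rfl⟩ := h' hτ
  rw [hc'.mem_pairCone_iff] at hxτ
  exact hΔ'.face_mem _ hτ _ (hc'.isFaceOf hxτ.1 hxτ.2)

theorem eq_of_fanSupport_eq {π : EE → E} {Δ Δ' : Set (PointedCone ℝ (EE → ℝ))}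
    (h : IsSubfan Δ (polystellahedralFan π)) (h' : IsSubfan Δ' (polystellahedralFan π))
    (hs : fanSupport Δ = fanSupport Δ') : Δ = Δ' :=
  (subset_of_fanSupport_subset h.2.2 h'.2.2 h'.2.1 hs.subset).antisymm
    (subset_of_fanSupport_subset h'.2.2 h.2.2 h.2.1 hs.symm.subset)

end Geometry

/-! ### Independence and flats in the multisymmetric lift -/

section Rank

open Finset

variable {E EE : Type*} [Fintype E] [DecidableEq E] [Fintype EE] [DecidableEq EE]
  {a : E → ℕ} {π : EE → E}

theorem preim_union (π : EE → E) (A B : Finset E) : preim π (A ∪ B) = preim π A ∪ preim π B := by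
  ext; simp

theorem preim_inter (π : EE → E) (A B : Finset E) : preim π (A ∩ B) = preim π A ∩ preim π B := by
  ext; simp

theorem preim_mono (π : EE → E) {A B : Finset E} (h : A ⊆ B) : preim π A ⊆ preim π B := by
  intro j hj
  rw [mem_preim] at hj ⊢
  exact h hj

theorem Polymatroid.rk_union_le_add_card (P : Polymatroid E a)
    (hπ : ∀ i, (univ.filter (fun j => π j = i)).card = a i) (B C : Finset E) :
    P.rk (B ∪ C) ≤ P.rk B + (preim π C).card := by
  induction C using Finset.induction_on with
  | empty => simp
  | insert i C hi ih =>
    have h := P.submodular (B ∪ C) {i}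
    have h1 := P.rk_singleton_le i
    have e : B ∪ C ∪ {i} = B ∪ insert i C := by
      ext; simp only [mem_union, mem_singleton, mem_insert]; tauto
    have e' : preim π (insert i C) = preim π C ∪ univ.filter (fun j => π j = i) := by
      ext; simp [or_comm]
    have hd : Disjoint (preim π C) (univ.filter (fun j => π j = i)) := by
      rw [disjoint_left]
      intro j hj hj'
      simp only [mem_preim, mem_filter, mem_univ, true_and] at hj hj'
      exact hi (hj' ▸ hj)
    rw [e] at h
    rw [e', card_union_of_disjoint hd, hπ]
    omega

/-- Marginal ranks decrease along inclusions. -/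
theorem Polymatroid.rk_union_add_le (P : Polymatroid E a) {A B : Finset E} (h : A ⊆ B)
    (C : Finset E) : P.rk (B ∪ C) + P.rk A ≤ P.rk (A ∪ C) + P.rk B := by
  have h1 := P.submodular (A ∪ C) B
  have e : A ∪ C ∪ B = B ∪ C := by
    ext x; have := @h x; simp only [mem_union]; tauto
  have h2 := P.monotone A ((A ∪ C) ∩ B) (subset_inter subset_union_left h)
  rw [e] at h1
  omega

theorem multisymmetricLift_rk_le (P : Polymatroid E a) (S : Finset EE) (A : Finset E) :
    (multisymmetricLift π P).rk S ≤ P.rk A + (S \ preim π A).card :=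
  ciInf_le (OrderBot.bddBelow _) A

theorem exists_multisymmetricLift_rk_eq (π : EE → E) (P : Polymatroid E a) (S : Finset EE) :
    ∃ A, (multisymmetricLift π P).rk S = P.rk A + (S \ preim π A).card :=
  exists_iInf_nat_eq (fun A : Finset E => P.rk A + (S \ preim π A).card)

/-- Testing `A = π(T)` gives one direction. For the other, split `T` along `π⁻¹(A)` for a minimiser
`A` and use the hypothesis on the part over `A`. -/
theorem multisymmetricLift_indep_iff (P : Polymatroid E a) (S : Finset EE) :
    (∀ T ⊆ S, T.card ≤ (multisymmetricLift π P).rk (T.image id)) ↔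
      ∀ T ⊆ S, T.card ≤ P.rk (T.image π) := by
  simp only [image_id]
  refine ⟨fun h T hT => ?_, fun h T hT => ?_⟩
  · refine (h T hT).trans ((multisymmetricLift_rk_le P T (T.image π)).trans_eq ?_)
    rw [sdiff_eq_empty_iff_subset.2, card_empty, add_zero]
    intro j hj
    exact (mem_preim _ _ _).2 (mem_image_of_mem π hj)
  · obtain ⟨A, hA⟩ := exists_multisymmetricLift_rk_eq π P T
    rw [hA, ← card_inter_add_card_sdiff T (preim π A)]
    refine Nat.add_le_add_right ((h _ (inter_subset_left.trans hT)).trans (P.monotone _ _ ?_)) _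
    intro i hi
    obtain ⟨j, hj, rfl⟩ := mem_image.1 hi
    exact (mem_preim _ _ _).1 (mem_inter.1 hj).2

/-- The elements whose fibre is contained in `G`. -/
def fiberCore (π : EE → E) (G : Finset EE) : Finset E :=
  univ.filter (fun i => ∀ j, π j = i → j ∈ G)

theorem mem_fiberCore {G : Finset EE} {i : E} : i ∈ fiberCore π G ↔ ∀ j, π j = i → j ∈ G := by
  simp [fiberCore]

theorem preim_fiberCore_subset (π : EE → E) (G : Finset EE) : preim π (fiberCore π G) ⊆ G :=
  fun j hj => mem_fiberCore.1 ((mem_preim _ _ _).1 hj) j rfl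

/-- Removing more elements of a set `A` whose preimage lies in `G` does not increase the
expression whose minimum is the rank of `G`. -/
theorem Polymatroid.rk_add_card_le (P : Polymatroid E a)
    (hπ : ∀ i, (univ.filter (fun j => π j = i)).card = a i) {G : Finset EE} {A : Finset E}
    (hA : preim π A ⊆ G) {B : Finset E} (hB : B ⊆ A) :
    P.rk A + (G \ preim π A).card ≤ P.rk B + (G \ preim π B).card := by
  have h := P.rk_union_le_add_card hπ B (A \ B)
  rw [union_sdiff_of_subset hB] at h
  have e : G \ preim π B = (G \ preim π A) ∪ preim π (A \ B) := by
    ext j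
    have h1 := @hA j
    have h2 := @hB (π j)
    simp only [mem_preim, mem_sdiff, mem_union] at h1 h2 ⊢
    tauto
  have hd : Disjoint (G \ preim π A) (preim π (A \ B)) := by
    rw [disjoint_left]
    intro j hj hj'
    simp only [mem_preim, mem_sdiff] at hj hj'
    exact hj.2 hj'.1
  rw [e, card_union_of_disjoint hd]
  omega

theorem card_sdiff_preim_union_image_add {G T : Finset EE} {A : Finset E}
    (hT : T ⊆ G \ preim π A) :
    (G \ preim π (A ∪ T.image π)).card + T.card ≤ (G \ preim π A).card := by
  rw [← card_sdiff_add_card_eq_card hT]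
  refine Nat.add_le_add_right (card_le_card fun j hj => ?_) _
  simp only [mem_sdiff, mem_preim, mem_union, not_or] at hj ⊢
  exact ⟨⟨hj.1, hj.2.1⟩, fun hjT => hj.2.2 (mem_image_of_mem π hjT)⟩

/-- Put `f(B) = rk B + |G \ π⁻¹(B)|`. Flatness of `G` forces every minimiser of `f` into the core
`A`; subsets of `A` never beat `A`, so `A` is the largest minimiser. The right-hand side says that
`f` increases strictly on enlarging `A`. -/
theorem multisymmetricLift_isFlat_iff (P : Polymatroid E a)
    (hπ : ∀ i, (univ.filter (fun j => π j = i)).card = a i) (G : Finset EE) :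
    (multisymmetricLift π P).IsFlat G ↔ P.IsFlat (fiberCore π G) ∧
      ∀ T ⊆ G \ preim π (fiberCore π G), T.Nonempty →
        P.rk (fiberCore π G) + T.card < P.rk (fiberCore π G ∪ T.image π) := by
  set A := fiberCore π G with hAdef
  have hAG : preim π A ⊆ G := preim_fiberCore_subset π G
  constructor
  · intro hG
    -- If a minimiser met a fibre not inside `G`, a missing element of that fibre could be added to
    -- `G` at no cost in rank.
    have hmin : ∀ B, (multisymmetricLift π P).rk G = P.rk B + (G \ preim π B).card → B ⊆ A := by
      intro B hB i hi
      refine mem_fiberCore.2 fun j hj => ?_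
      by_contra hjG
      have h1 := hG j hjG
      have h2 := multisymmetricLift_rk_le (π := π) P (insert j G) B
      rw [insert_sdiff_of_mem _ ((mem_preim _ _ _).2 (hj ▸ hi))] at h2
      omega
    obtain ⟨B, hB⟩ := exists_multisymmetricLift_rk_eq π P G
    have hA := P.rk_add_card_le hπ hAG (hmin B hB)
    have hlt : ∀ C, ¬ C ⊆ A → P.rk A + (G \ preim π A).card < P.rk C + (G \ preim π C).card := by
      intro C hC
      have h1 := multisymmetricLift_rk_le (π := π) P G C
      rcases h1.lt_or_eq with h2 | h2
      · omega
      · exact absurd (hmin C h2) hC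
    refine ⟨fun i hi => ?_, fun T hT hne => ?_⟩
    · have h1 := hlt (insert i A) fun h => hi (h (mem_insert_self i A))
      have h2 := card_le_card (sdiff_subset_sdiff (subset_refl G)
        (preim_mono π (subset_insert i A)))
      omega
    · have h1 := hlt (A ∪ T.image π) fun h => by
        obtain ⟨j, hj⟩ := hne
        exact (mem_sdiff.1 (hT hj)).2 ((mem_preim _ _ _).2
          (h (mem_union_right _ (mem_image_of_mem π hj))))
      have h2 := card_sdiff_preim_union_image_add hT
      omega
  · rintro ⟨hfl, hT⟩ j hj
    obtain ⟨B, hB⟩ := exists_multisymmetricLift_rk_eq π P (insert j G)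
    rw [hB]
    by_cases hjB : π j ∈ B
    · rw [insert_sdiff_of_mem _ ((mem_preim _ _ _).2 hjB)]
      have hjA : π j ∉ A := fun h => hj (mem_fiberCore.1 h j rfl)
      -- Submodularity of `f` with `f(A ∩ B) ≥ f(A)` and `f(A ∪ B) > f(A)` yields `f(B) > f(A)`.
      have h1 := P.submodular A B
      have h2 : (G \ preim π (A ∩ B)).card + (G \ preim π (A ∪ B)).card =
          (G \ preim π A).card + (G \ preim π B).card := by
        rw [preim_inter, preim_union, sdiff_inter_distrib_right, sdiff_union_distrib,
          card_union_add_card_inter]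
      have h3 := P.rk_add_card_le hπ hAG (B := A ∩ B) inter_subset_left
      have h4 := multisymmetricLift_rk_le (π := π) P G A
      have h5 : P.rk A + (G \ preim π A).card <
          P.rk (A ∪ B) + (G \ preim π (A ∪ B)).card := by
        have e : G \ preim π (A ∪ B) =
            (G \ preim π A) \ ((G \ preim π A) ∩ preim π B) := by
          ext; simp only [preim_union, mem_sdiff, mem_union, mem_inter]; tauto
        have e' := card_sdiff_add_card_eq_card
          (inter_subset_left (s₁ := G \ preim π A) (s₂ := preim π B))
        rw [← e] at e'
        -- If passing to `A ∪ B` covers no new element of `G`, flatness of `A` gives strictness;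
        -- otherwise the rank condition on the newly covered elements does.
        rcases ((G \ preim π A) ∩ preim π B).eq_empty_or_nonempty with h | h
        · rw [h, card_empty] at e'
          have := hfl _ hjA
          have := P.monotone (insert (π j) A) (A ∪ B)
            (insert_subset (mem_union_right _ hjB) subset_union_left)
          omega
        · have := hT _ inter_subset_left h
          have := P.monotone (A ∪ ((G \ preim π A) ∩ preim π B).image π) (A ∪ B) (by
            refine union_subset_union_right fun i hi => ?_
            obtain ⟨k, hk, rfl⟩ := mem_image.1 hi
            exact (mem_preim _ _ _).1 (mem_inter.1 hk).2)
          omega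
      omega
    · rw [insert_sdiff_of_notMem _ (fun h => hjB ((mem_preim _ _ _).1 h)),
        card_insert_of_notMem (fun h => hj (mem_sdiff.1 h).1)]
      have := multisymmetricLift_rk_le (π := π) P G B
      omega

end Rank

/-! ### Comparison of supports and coarsening -/

section Main

open Finset

variable {E EE : Type*} [Fintype E] [DecidableEq E] [Fintype EE] [DecidableEq EE]
  {a : E → ℕ} {π : EE → E}

/-- The pairs indexing the cones of the augmented Bergman fan of `P`. -/
structure IsBergmanPair (π : EE → E) (P : Polymatroid E a) (S : Finset EE)
    (𝓕 : Finset (Finset E)) : Prop where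
  compatible : CompatiblePair π S 𝓕
  isFlat : ∀ F ∈ 𝓕, P.IsFlat F
  card_le : ∀ T ⊆ S, T.card ≤ P.rk (T.image π)
  lt_rk : ∀ F ∈ 𝓕, ∀ T ⊆ S \ preim π F, T.Nonempty → P.rk F + T.card < P.rk (F ∪ T.image π)

theorem IsBergmanPair.mono {P : Polymatroid E a} {I I' : Finset EE} {𝓕 𝓕' : Finset (Finset E)}
    (h : IsBergmanPair π P I 𝓕) (hI : I' ⊆ I) (hF : 𝓕' ⊆ 𝓕) : IsBergmanPair π P I' 𝓕' where
  compatible := h.compatible.mono hI hF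
  isFlat F hF' := h.isFlat F (hF hF')
  card_le T hT := h.card_le T (hT.trans hI)
  lt_rk F hF' T hT := h.lt_rk F (hF hF') T (hT.trans (sdiff_subset_sdiff hI subset_rfl))

theorem isBergmanPair_empty (π : EE → E) (P : Polymatroid E a) : IsBergmanPair π P ∅ ∅ where
  compatible := ⟨by simp, by simp, by simp⟩
  isFlat := by simp
  card_le T hT := by simp [subset_empty.1 hT]
  lt_rk := by simp

theorem augBergmanFan_eq (π : EE → E) (P : Polymatroid E a) :
    augBergmanFan π P = {σ | ∃ I 𝓕, IsBergmanPair π P I 𝓕 ∧ σ = pairCone π I 𝓕} := by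
  ext σ
  constructor
  · rintro ⟨S, 𝓕, h1, h2, h3, h4, rfl⟩
    exact ⟨S, 𝓕, ⟨h1, h2, h3, h4⟩, rfl⟩
  · rintro ⟨S, 𝓕, ⟨h1, h2, h3, h4⟩, rfl⟩
    exact ⟨S, 𝓕, h1, h2, h3, h4, rfl⟩

theorem isFan_augBergmanFan (π : EE → E) (P : Polymatroid E a) : IsFan (augBergmanFan π P) := by
  rw [augBergmanFan_eq]
  exact isFan_of_downClosed _ (fun _ _ h => h.compatible) (isBergmanPair_empty π P)
    fun _ _ _ _ h => h.mono

theorem mem_fanSupport_augBergmanFan {P : Polymatroid E a} {x : EE → ℝ} :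
    x ∈ fanSupport (augBergmanFan π P) ↔
      IsBergmanPair π P (supportSet π x) (supportChain π x) := by
  rw [augBergmanFan_eq]
  exact mem_fanSupport_of_downClosed _ (fun _ _ h => h.compatible) fun _ _ _ _ h => h.mono

theorem mem_supportSet_id {x : EE → ℝ} {j : EE} : j ∈ supportSet id x ↔ 0 < x j := by
  simp [fiberFloor_id]

theorem supportSet_id_subset (π : EE → E) (x : EE → ℝ) : supportSet id x ⊆ supportSet π x :=
  fun _ hj => mem_supportSet.2 ((fiberFloor_nonpos _ _ _).trans_lt (mem_supportSet_id.1 hj))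

theorem mem_supportChain_id {x : EE → ℝ} {G : Finset EE} :
    G ∈ supportChain id x ↔ ∃ j, x j < 0 ∧ univ.filter (fun k => x j < x k) = G := by
  rw [supportChain, mem_levelChain]
  refine exists_congr fun j => ?_
  have h : fiberFloor id x j < 0 ↔ x j < 0 := by simp [fiberFloor_id]
  rw [h]
  refine and_congr_right fun hj => ?_
  have : univ.filter (fun k => fiberFloor id x j < fiberFloor id x k) =
      univ.filter (fun k => x j < x k) := by
    ext k
    simp [fiberFloor_id, hj, min_eq_right hj.le]
  rw [this]

/-- The link between flats of the lift and flats of `P`; negativity of `t` makes the default `0` in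
the floor harmless. -/
theorem fiberCore_superlevel (π : EE → E) (x : EE → ℝ) {t : ℝ} (ht : t < 0) :
    fiberCore π (univ.filter fun k => t < x k) = univ.filter fun i => t < fiberFloor π x i := by
  ext i
  simp [mem_fiberCore, lt_fiberFloor, ht]

/-- The threshold need not be a value of `y`: lower it to the largest value not exceeding it. -/
theorem filter_lt_mem_levelChain {y : E → ℝ} {i : E} {t : ℝ} (hi : y i ≤ t) (ht : t < 0) :
    univ.filter (fun k => t < y k) ∈ levelChain y := by
  obtain ⟨m, hm, hmax⟩ := exists_max_image (univ.filter fun k => y k ≤ t) y ⟨i, by simpa using hi⟩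
  simp only [mem_filter, mem_univ, true_and] at hm hmax
  refine mem_levelChain.2 ⟨m, hm.trans_lt ht, ?_⟩
  ext k
  simp only [mem_filter, mem_univ, true_and]
  exact ⟨fun hk => lt_of_not_ge fun h => (hmax k h).not_gt hk, fun hk => hm.trans_lt hk⟩

/-- The strict marginal rank condition for `T` over `F` passes to the subsets of `F`. -/
theorem Polymatroid.rk_add_card_lt_of_subset (P : Polymatroid E a) {B F : Finset E} (hB : B ⊆ F)
    {T : Finset EE} (hT : P.rk F + T.card < P.rk (F ∪ T.image π)) :
    P.rk B + T.card < P.rk (B ∪ T.image π) := by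
  have := P.rk_union_add_le hB (T.image π)
  omega

theorem isBergmanPair_support_iff (P : Polymatroid E a)
    (hπ : ∀ i, (univ.filter (fun j => π j = i)).card = a i) (x : EE → ℝ) :
    IsBergmanPair π P (supportSet π x) (supportChain π x) ↔
      IsBergmanPair id (multisymmetricLift π P) (supportSet id x) (supportChain id x) := by
  constructor
  · intro h
    have hfl : ∀ G ∈ supportChain id x, (multisymmetricLift π P).IsFlat G := by
      intro G hG
      obtain ⟨j, hj, rfl⟩ := mem_supportChain_id.1 hG
      rw [multisymmetricLift_isFlat_iff P hπ, fiberCore_superlevel π x hj]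
      have hF := filter_lt_mem_levelChain (fiberFloor_le π x j) hj
      refine ⟨h.isFlat _ hF, fun T hT => h.lt_rk _ hF T (hT.trans fun k hk => ?_)⟩
      simp only [mem_sdiff, mem_filter, mem_univ, true_and, mem_preim, not_lt,
        mem_supportSet] at hk ⊢
      exact ⟨hk.2.trans_lt hk.1, hk.2⟩
    refine ⟨compatiblePair_support id x, hfl, ?_, fun F hF T hT hne => ?_⟩
    · rw [multisymmetricLift_indep_iff]
      exact fun T hT => h.card_le T (hT.trans (supportSet_id_subset π x))
    -- Vacuous for `id`: each chain member is cut at a negative level, so it contains every positive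
    -- coordinate.
    · obtain ⟨k, hk⟩ := hne
      obtain ⟨j, hj, rfl⟩ := mem_supportChain_id.1 hF
      have hk' := mem_sdiff.1 (hT hk)
      rw [mem_supportSet_id] at hk'
      simp only [mem_preim, id_eq, mem_filter, mem_univ, true_and] at hk'
      exact absurd (hj.trans hk'.1) hk'.2
  · intro h
    have hflat : ∀ j, x j < 0 → P.IsFlat (univ.filter fun i => x j < fiberFloor π x i) ∧
        ∀ T ⊆ (univ.filter fun k => x j < x k) \
          preim π (univ.filter fun i => x j < fiberFloor π x i), T.Nonempty →
          P.rk (univ.filter fun i => x j < fiberFloor π x i) + T.card <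
            P.rk ((univ.filter fun i => x j < fiberFloor π x i) ∪ T.image π) := by
      intro j hj
      have := (multisymmetricLift_isFlat_iff P hπ _).1
        (h.isFlat _ (mem_supportChain_id.2 ⟨j, hj, rfl⟩))
      rwa [fiberCore_superlevel π x hj] at this
    have hind := (multisymmetricLift_indep_iff (π := π) P _).1 h.card_le
    -- Let `s` be the lowest floor over `T` and `T₀` the part of `T` strictly above it. The flat of
    -- the lift at level `s` controls the marginal rank of `T \ T₀`, and this bound passes down to
    -- the smaller set `B ∪ π(T₀)`. Induction then handles `T₀`.
    have hpeel : ∀ T ⊆ supportSet π x, ∀ k ∈ T, fiberFloor π x (π k) < 0 →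
        ∃ s < 0, s ≤ fiberFloor π x (π k) ∧ ∃ T₀ ⊂ T, ∀ B : Finset E,
          B ⊆ univ.filter (fun i => s < fiberFloor π x i) →
          P.rk (B ∪ T₀.image π) + (T.card - T₀.card) < P.rk (B ∪ T.image π) := by
      intro T hT k hk hk0
      obtain ⟨m, hm, hmin⟩ := exists_min_image T (fun j => fiberFloor π x (π j)) ⟨k, hk⟩
      have hm0 := (hmin k hk).trans_lt hk0
      obtain ⟨j, -, hj⟩ := exists_eq_fiberFloor hm0
      set s := fiberFloor π x (π m) with hs
      have hsub : T.filter (fun j => s < fiberFloor π x (π j)) ⊂ T := by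
        refine (filter_ssubset (s := T)).2 ⟨m, hm, lt_irrefl _⟩
      refine ⟨s, hm0, hmin k hk, _, hsub, fun B hB => ?_⟩
      set T₀ := T.filter (fun j => s < fiberFloor π x (π j)) with hT₀
      have h1 := (hflat j (hj ▸ hm0)).2 (T \ T₀) (fun l hl => ?_) (sdiff_nonempty.2 hsub.2)
      · rw [hj] at h1
        have h2 := P.rk_add_card_lt_of_subset (B := B ∪ T₀.image π)
          (union_subset hB fun i hi => ?_) h1
        · rw [union_assoc, ← image_union, union_sdiff_of_subset hsub.1,
            card_sdiff_of_subset hsub.1] at h2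
          exact h2
        · obtain ⟨l, hl, rfl⟩ := mem_image.1 hi
          simpa using (mem_filter.1 hl).2
      · rw [mem_sdiff, hT₀, mem_filter] at hl
        have h2 := mem_supportSet.1 (hT hl.1)
        have h3 : ¬ s < fiberFloor π x (π l) := fun h => hl.2 ⟨hl.1, h⟩
        simp only [mem_sdiff, mem_filter, mem_univ, true_and, mem_preim, hj]
        exact ⟨(hmin l hl.1).trans_lt h2, h3⟩
    refine ⟨compatiblePair_support π x, fun F hF => ?_, fun T => ?_, fun F hF T => ?_⟩
    · obtain ⟨i, hi, rfl⟩ := mem_levelChain.1 hF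
      obtain ⟨j, -, hj⟩ := exists_eq_fiberFloor hi
      have := (hflat j (hj ▸ hi)).1
      rwa [hj] at this
    · induction T using Finset.strongInduction with
      | H T ih =>
        intro hT
        by_cases hk : ∃ k ∈ T, fiberFloor π x (π k) < 0
        · obtain ⟨k, hk, hk0⟩ := hk
          obtain ⟨s, -, -, T₀, hT₀, H⟩ := hpeel T hT k hk hk0
          have h1 := H ∅ (empty_subset _)
          have h2 := ih T₀ hT₀ (hT₀.1.trans hT)
          rw [empty_union, empty_union] at h1
          omega
        -- With no negative floor left, all coordinates in `T` are positive, so independence in the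
        -- lift applies.
        · push Not at hk
          refine hind T fun k hkT => mem_supportSet_id.2 ?_
          exact (hk k hkT).trans_lt (mem_supportSet.1 (hT hkT))
    · obtain ⟨i, hi, rfl⟩ := mem_levelChain.1 hF
      induction T using Finset.strongInduction with
      | H T ih =>
        intro hT hne
        obtain ⟨k, hk⟩ := hne
        have hk' := (mem_sdiff.1 (hT hk)).2
        simp only [mem_preim, mem_filter, mem_univ, true_and, not_lt] at hk'
        obtain ⟨s, -, hs, T₀, hT₀, H⟩ := hpeel T (hT.trans sdiff_subset) k hk (hk'.trans_lt hi)
        -- Since `T` avoids `F`, its lowest floor is at most the level defining `F`, so `B = F` is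
        -- admissible.
        have h1 := H (univ.filter fun l => fiberFloor π x i < fiberFloor π x l) (fun l hl => by
          simp only [mem_filter, mem_univ, true_and] at hl ⊢
          exact (hs.trans hk').trans_lt hl)
        have h3 := card_lt_card hT₀
        rcases T₀.eq_empty_or_nonempty with h2 | h2
        · subst h2
          rw [image_empty, union_empty, card_empty] at h1
          omega
        · have := ih T₀ hT₀ (hT₀.1.trans hT) h2
          omega

theorem fanSupport_augBergmanFan_eq (P : Polymatroid E a)
    (hπ : ∀ i, (univ.filter (fun j => π j = i)).card = a i) :
    fanSupport (augBergmanFan π P) =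
      fanSupport (matroidAugBergmanFan (multisymmetricLift π P)) := by
  ext x
  rw [matroidAugBergmanFan_eq, mem_fanSupport_augBergmanFan, mem_fanSupport_augBergmanFan,
    isBergmanPair_support_iff P hπ]

/-- The normal form with respect to `π` depends monotonically on the one with respect to the
identity. -/
theorem support_subset_of_support_id_subset (π : EE → E) {x z : EE → ℝ}
    (hS : supportSet id x ⊆ supportSet id z) (hC : supportChain id x ⊆ supportChain id z) :
    supportSet π x ⊆ supportSet π z ∧ supportChain π x ⊆ supportChain π z := by
  -- Inclusion of the chains means that `z` preserves strict inequalities above negative coordinates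
  -- of `x`.
  have hneg : ∀ j, x j < 0 → z j < 0 ∧ ∀ k, x j < x k → z j < z k := by
    intro j hj
    obtain ⟨l, hl, he⟩ := mem_supportChain_id.1 (hC (mem_supportChain_id.2 ⟨j, hj, rfl⟩))
    have hiff : ∀ k, z l < z k ↔ x j < x k := fun k => by simpa using Finset.ext_iff.1 he k
    have hjl : z j ≤ z l := not_lt.1 fun h => lt_irrefl _ ((hiff j).1 h)
    exact ⟨hjl.trans_lt hl, fun k hk => hjl.trans_lt ((hiff k).2 hk)⟩
  have hneg' : ∀ i, fiberFloor π x i < 0 → fiberFloor π z i < 0 ∧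
      ∀ k, fiberFloor π x i < fiberFloor π x k → fiberFloor π z i < fiberFloor π z k := by
    intro i hi
    obtain ⟨j, rfl, hj⟩ := exists_eq_fiberFloor hi
    rw [← hj] at hi ⊢
    have hle := fiberFloor_le π z j
    refine ⟨hle.trans_lt (hneg j hi).1, fun k hk => hle.trans_lt (lt_fiberFloor.2
      ⟨(hneg j hi).1, fun l hl => (hneg j hi).2 l ((lt_fiberFloor.1 hk).2 l hl)⟩)⟩
  constructor
  · intro j hj
    rw [mem_supportSet] at hj ⊢
    rcases lt_or_ge 0 (x j) with h | h
    · exact (fiberFloor_nonpos _ _ _).trans_lt (mem_supportSet_id.1 (hS (mem_supportSet_id.2 h)))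
    · obtain ⟨k, hk, hkx⟩ := exists_eq_fiberFloor (hj.trans_le h)
      rw [← hk]
      refine (fiberFloor_le π z k).trans_lt ((hneg k ?_).2 j ?_)
      · exact hkx ▸ hj.trans_le h
      · rwa [hkx]
  · intro F hF
    obtain ⟨i, hi, rfl⟩ := mem_levelChain.1 hF
    -- Among the indices outside `F`, the one with highest floor for `z` has `F` as its level set.
    obtain ⟨m, hm, hmax⟩ := exists_max_image
      (univ.filter fun k => fiberFloor π x k ≤ fiberFloor π x i) (fiberFloor π z) ⟨i, by simp⟩
    simp only [mem_filter, mem_univ, true_and] at hm hmax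
    have hm' := hneg' m (hm.trans_lt hi)
    refine mem_levelChain.2 ⟨m, hm'.1, ?_⟩
    ext k
    simp only [mem_filter, mem_univ, true_and]
    exact ⟨fun hk => lt_of_not_ge fun h => (hmax k h).not_gt hk,
      fun hk => hm'.2 k (hm.trans_lt hk)⟩

/-- A cone of the lift's fan is the `id`-normal form cone of some `z`; the `π`-normal form cone of
the same `z` contains it. -/
theorem isCoarsening_augBergmanFan (P : Polymatroid E a)
    (hπ : ∀ i, (univ.filter (fun j => π j = i)).card = a i) :
    IsCoarsening (augBergmanFan π P) (matroidAugBergmanFan (multisymmetricLift π P)) := by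
  rw [IsCoarsening, ← fanSupport_augBergmanFan_eq P hπ, matroidAugBergmanFan_eq]
  refine ⟨isFan_augBergmanFan π P, isFan_augBergmanFan id _, rfl, fun σ hσ => ?_⟩
  rw [augBergmanFan_eq] at hσ
  obtain ⟨I, 𝓕, h, rfl⟩ := hσ
  obtain ⟨z, rfl, rfl⟩ := h.compatible.exists_support_eq
  refine ⟨pairCone π (supportSet π z) (supportChain π z), ?_, fun x hx => ?_⟩
  · rw [augBergmanFan_eq]
    exact ⟨_, _, (isBergmanPair_support_iff P hπ z).2 h, rfl⟩
  · rw [h.compatible.mem_pairCone_iff] at hx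
    rw [(compatiblePair_support π z).mem_pairCone_iff]
    exact support_subset_of_support_id_subset π hx.1 hx.2

end Main

theorem mainTheorem6 {E EE : Type*} [Fintype E] [DecidableEq E] [Fintype EE] [DecidableEq EE]
    (a : E → ℕ) (π : EE → E) (hπ : ∀ i, (Finset.univ.filter (fun j => π j = i)).card = a i)
    (P : Polymatroid E a) :
    -- `Σ_P` is a subfan of `Σ_π` with the same support as the fan of the multisymmetric lift
    IsSubfan (augBergmanFan π P) (polystellahedralFan π) ∧
    fanSupport (augBergmanFan π P) = fanSupport (matroidAugBergmanFan (multisymmetricLift π P)) ∧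
    -- and it is the only such subfan
    (∀ Δ : Set (PointedCone ℝ (EE → ℝ)), IsSubfan Δ (polystellahedralFan π) →
      fanSupport Δ = fanSupport (matroidAugBergmanFan (multisymmetricLift π P)) →
      Δ = augBergmanFan π P) ∧
    -- it coarsens the fan of the multisymmetric lift
    IsCoarsening (augBergmanFan π P) (matroidAugBergmanFan (multisymmetricLift π P)) ∧
    -- and it is the only coarsening that is a subfan of `Σ_π`
    (∀ Δ : Set (PointedCone ℝ (EE → ℝ)), IsSubfan Δ (polystellahedralFan π) →
      IsCoarsening Δ (matroidAugBergmanFan (multisymmetricLift π P)) →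
      Δ = augBergmanFan π P) := by
  have hsub : IsSubfan (augBergmanFan π P) (polystellahedralFan π) :=
    ⟨isFan_polystellahedralFan π, isFan_augBergmanFan π P, by
      rintro _ ⟨S, 𝓕, h, -, -, -, rfl⟩
      exact ⟨S, 𝓕, h, rfl⟩⟩
  have hsupp := fanSupport_augBergmanFan_eq P hπ
  exact ⟨hsub, hsupp, fun Δ hΔ h => eq_of_fanSupport_eq hΔ hsub (h.trans hsupp.symm),
    isCoarsening_augBergmanFan P hπ,
    fun Δ hΔ h => eq_of_fanSupport_eq hΔ hsub (h.2.2.1.trans hsupp.symm)⟩
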